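/- There are universal constants $c_1,c_2>0$ such that the following holds. Let $N,K\ge 1$ and $d\ge 1$ be integers, $x_1,\dots,x_N\in\mathbb R^d$ item features with $\max_j\|x_j\|_2\le C_x$, and $\widetilde\Theta\subset\mathbb R^d$ a set with $\sup_{\theta\in\widetilde\Theta}\|\theta\|_2\le C_\Theta$. Let $\mathcal P$ be the family of latent class logit (LCL) models, i.e. of the choice models $$p(a\mid s)=\sum_{k=1}^K\lambda_k\frac{\exp(x_a^\top\theta_k)}{1+\sum_{j\in s}\exp(x_j^\top\theta_k)}\ (a\in s),\qquad p(0\mid s)=\sum_{k=1}^K\frac{\lambda_k}{1+\sum_{j\in s}\exp(x_j^\top\theta_k)},$$ with $p(a\mid s)=0$ for other $a$, $\theta_1,\dots,\theta_K\in\widetilde\Theta$, and $\lambda_k\ge0$, $\sum_k\lambda_k=1$. Let $\mathbb S\subseteq 2^{[N]}\setminus\{\emptyset\}$ be the collection of feasible assortments, $r(s,a)\ge 0$ ($s\in\mathbb S$, $a\in s$) the known revenues, $\mathcal V(s;p)=\sum_{a\in s}p(a\mid s)r(s,a)$, and let $p_0\in\mathcal P$ be the true choice model. Let $(S_i,A_i)_{i=1}^n$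 be i.i.d. with probability mass function $\pi_S(s)p_0(a\mid s)$, where $\pi_S$ is a probability distribution on $\mathbb S$, and let $s^\star\in\arg\max_{s\in\mathbb S}\mathcal V(s;p_0)$ be an optimal assortment with $\pi_S(s^\star)>0$. Put $r_{s^\star}=\max_{j\in s^\star}r(s^\star,j)$. For $\alpha>0$ let $\Omega_n(\alpha)=\{p\in\mathcal P:\widehat L_n(p)-\inf_{q\in\mathcal P}\widehat L_n(q)\le\alpha\}$, where $\widehat L_n(p)=-\frac1n\sum_{i=1}^n\log p(A_i\mid S_i)$; the infimum is $\widehat L_n(\widehat p_n)$ whenever a maximum likelihood estimator $\widehat p_n$ exists. PASTA with the uncertainty set $\Omega_n(\alpha)$ returns an assortment $\widehat s\in\arg\max_{s\in\mathbb S}\inf_{p\in\Omega_n(\alpha)}\mathcal V(s;p)$, with regret $\mathcal R(\widehat s)=\mathcal V(s^\star;p_0)-\mathcal V(\widehat s;p_0)$. Let $D=Kd+K-1$ and $C=KN\exp(C_\Theta C_x)$, and assume $n\ge D$ (so that $\log(n/D)\ge 0$; then also $n\ge D\log(n/D)$). Then for every $\delta\in(0,1)$ and every critical value $$\alpha\ \ge\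 c_1\Big(\frac Dn\log\frac{Cn}{D}+\frac1n\log\frac1\delta\Big),$$ in particular for $\alpha=\alpha_n(\delta)$ equal to the right-hand side, with probability at least $1-\delta$ every solution $\widehat s$ that PASTA with the uncertainty set $\Omega_n(\alpha)$ may return satisfies $$\mathcal R(\widehat s)\ \le\ c_2\,r_{s^\star}\sqrt{\frac{\alpha}{\pi_S(s^\star)}}.$$ -/

import Mathlib

open MeasureTheory ProbabilityTheory

namespace PASTA

noncomputable section

/-- A conditional choice model for `N` items: `p s a` is the probability `p(a | s)` of choosing `a`
when the assortment `s` is offered; `none` is the no-purchase option `0`. -/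
abbrev ChoiceModel (N : ℕ) : Type := Finset (Fin N) → Option (Fin N) → ℝ

/-- One observation: the offered assortment and the customer's choice. -/
abbrev Observation (N : ℕ) : Type := Finset (Fin N) × Option (Fin N)

/-- The multinomial logit model with item features `x` and parameter `θ`. -/
def mnl {N d : ℕ} (x : Fin N → EuclideanSpace ℝ (Fin d)) (θ : EuclideanSpace ℝ (Fin d)) :
    ChoiceModel N
  | s, none => 1 / (1 + ∑ j ∈ s, Real.exp (inner ℝ (x j) θ))
  | s, some a =>
      if a ∈ s then Real.exp (inner ℝ (x a) θ) / (1 + ∑ j ∈ s, Real.exp (inner ℝ (x j) θ)) else 0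

/-- The latent class logit model: the mixture of `K` multinomial logit models with parameters
`θ k` and mixture weights `w k`. -/
def lcl {N d K : ℕ} (x : Fin N → EuclideanSpace ℝ (Fin d))
    (θ : Fin K → EuclideanSpace ℝ (Fin d)) (w : Fin K → ℝ) : ChoiceModel N :=
  fun s a => ∑ k, w k * mnl x (θ k) s a

/-- The family of latent class logit models with component parameters in `T` and weights in the
probability simplex. -/
def lclFamily {N d : ℕ} (K : ℕ) (x : Fin N → EuclideanSpace ℝ (Fin d))
    (T : Set (EuclideanSpace ℝ (Fin d))) : Set (ChoiceModel N) :=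
  {p | ∃ θ : Fin K → EuclideanSpace ℝ (Fin d), ∃ w ∈ stdSimplex ℝ (Fin K),
    (∀ k, θ k ∈ T) ∧ p = lcl x θ w}

/-- The expected revenue `V(s; p)` of the assortment `s` under the choice model `p`. -/
def value {N : ℕ} (r : Finset (Fin N) → Fin N → ℝ) (p : ChoiceModel N) (s : Finset (Fin N)) : ℝ :=
  ∑ a ∈ s, p s (some a) * r s a

/-- The largest revenue among the items of the assortment `s`. -/
def maxRevenue {N : ℕ} (r : Finset (Fin N) → Fin N → ℝ) (s : Finset (Fin N)) : ℝ :=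
  ⨆ j : {j // j ∈ s}, r s j

/-- `s` maximizes the expected revenue under `p` over the collection `𝕊`. -/
def IsOptimal {N : ℕ} (𝕊 : Finset (Finset (Fin N))) (r : Finset (Fin N) → Fin N → ℝ)
    (p : ChoiceModel N) (s : Finset (Fin N)) : Prop :=
  s ∈ 𝕊 ∧ ∀ t ∈ 𝕊, value r p t ≤ value r p s

/-- The average negative log-likelihood of `p` on a dataset. -/
def empLoss {N n : ℕ} (D : Fin n → Observation N) (p : ChoiceModel N) : ℝ :=
  -(1 / (n : ℝ)) * ∑ i, Real.log (p (D i).1 (D i).2)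

/-- The set of `α`-minimizers of the empirical loss over the family `P`. It makes sense also when
the infimum over `P` is not attained; see `uncertaintySet_eq_of_mle` for the case that it is. -/
def uncertaintySet {N n : ℕ} (P : Set (ChoiceModel N)) (D : Fin n → Observation N) (α : ℝ) :
    Set (ChoiceModel N) :=
  {p | p ∈ P ∧ ∀ q ∈ P, empLoss D p - empLoss D q ≤ α}

/-- If `pHat` is a maximum likelihood estimator, the uncertainty set consists of the `p ∈ P` whose
loss exceeds that of `pHat` by at most `α`. -/
theorem uncertaintySet_eq_of_mle {N n : ℕ} (P : Set (ChoiceModel N)) (D : Fin n → Observation N)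
    (α : ℝ) (pHat : ChoiceModel N) (hP : pHat ∈ P) (hmin : ∀ q ∈ P, empLoss D pHat ≤ empLoss D q) :
    uncertaintySet P D α = {p | p ∈ P ∧ empLoss D p - empLoss D pHat ≤ α} := by
  ext p
  refine ⟨fun h => ⟨h.1, h.2 pHat hP⟩, fun h => ⟨h.1, fun q hq => ?_⟩⟩
  have h1 := hmin q hq
  have h2 := h.2
  linarith

/-- The worst-case revenue of `s` over the uncertainty set. -/
def worstValue {N n : ℕ} (P : Set (ChoiceModel N)) (r : Finset (Fin N) → Fin N → ℝ)
    (D : Fin n → Observation N) (α : ℝ) (s : Finset (Fin N)) : ℝ :=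
  sInf ((fun p => value r p s) '' uncertaintySet P D α)

/-- The solutions of the max-min problem: the assortments in `𝕊` that PASTA may return. -/
def solutions {N n : ℕ} (𝕊 : Finset (Finset (Fin N))) (P : Set (ChoiceModel N))
    (r : Finset (Fin N) → Fin N → ℝ) (D : Fin n → Observation N) (α : ℝ) :
    Set (Finset (Fin N)) :=
  {s | s ∈ 𝕊 ∧ ∀ t ∈ 𝕊, worstValue P r D α t ≤ worstValue P r D α s}

/-- The regret of the assortment `s` relative to the optimal assortment `sStar`, under the true
model `p₀`. -/
def regret {N : ℕ} (r : Finset (Fin N) → Fin N → ℝ) (p₀ : ChoiceModel N)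
    (sStar s : Finset (Fin N)) : ℝ :=
  value r p₀ sStar - value r p₀ s

/-- The data are i.i.d. with probability mass function `(s, a) ↦ π s * p₀ s a`. The finite set of
observations carries its discrete σ-algebra `⊤`. -/
structure IsOfflineSample {Ω : Type*} [MeasurableSpace Ω] {N n : ℕ} (μ : Measure Ω)
    (π : Finset (Fin N) → ℝ) (p₀ : ChoiceModel N) (data : Fin n → Ω → Observation N) : Prop where
  measurable : ∀ i, @Measurable Ω (Observation N) _ ⊤ (data i)
  indep : iIndepFun (m := fun _ : Fin n => (⊤ : MeasurableSpace (Observation N))) data μ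
  law : ∀ i s a, μ.real {ω | data i ω = (s, a)} = π s * p₀ s a

/-- The effective dimension `K d + K - 1`. -/
def effDim (K d : ℕ) : ℝ := (K : ℝ) * d + K - 1

/-- The rate `(D / n) log (C n / D) + (1 / n) log (1 / δ)`. -/
def rate (D C : ℝ) (n : ℕ) (δ : ℝ) : ℝ :=
  D / n * Real.log (C * n / D) + 1 / n * Real.log (1 / δ)

end

end PASTA

/-! Pessimism reduces the problem to the single assortment `sStar`. If `p₀` lies in the uncertainty
set, the worst value of a returned `s` is at most its true value and at least the worst value of
`sStar`, so the regret is at most the largest drop of the value of `sStar` over the set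
(`regret_le_of_mem_solutions`). Hence only the `ℓ¹` distance between `p s` and `p₀ s` at `s = sStar`
matters, at the price of a factor `1 / √(π sStar)`.

Two likelihood facts are needed, uniformly over the family; both follow from exponential Markov
bounds and a union bound over a finite upper cover. If `u` dominates `q`, the product of the ratios
`u / p₀` has mean at most `(1 + η) ^ n`, so no `q` beats `p₀` by more than `α`
(`mem_uncertaintySet_of_prod_lt`). The product of the square roots of the ratios has mean `affinity
^ n`, so a `p` in the uncertainty set has a dominating `u` with affinity close to one
(`one_sub_affinity_le`), hence is close to `p₀` in Hellinger and `ℓ¹` distance (`sum_abs_sub_le`).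
No lower bound on the choice probabilities enters.

For mixtures of logits, a net of the parameter ball and a grid of weights give a cover at scale `D /
n` with log-cardinality of order `D log (C n / D)` (`exists_isUpperCover_lclFamily`,
`cover_card_le_exp`), which matches the critical value. -/

namespace PASTA

/-! ### Nets of balls in finite-dimensional normed spaces -/

section Covering

open Metric Module
open scoped Function ENNReal

variable {E : Type*} [NormedAddCommGroup E] [NormedSpace ℝ E] [FiniteDimensional ℝ E]

/-- Volume bound for the cardinality of an `ε`-separated subset of the ball of radius `R`. -/
theorem card_le_of_separated {R ε : ℝ} (hR : 0 ≤ R) (hε : 0 < ε) (s : Finset E)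
    (hs : ∀ c ∈ s, ‖c‖ ≤ R) (h : ∀ c ∈ s, ∀ d ∈ s, c ≠ d → ε ≤ ‖c - d‖) :
    (s.card : ℝ) ≤ (1 + 2 * R / ε) ^ finrank ℝ E := by
  borelize E
  let μ : Measure E := Measure.addHaar
  have hδ : 0 < ε / 2 := by positivity
  have hρ : 0 < R + ε / 2 := by positivity
  set A := ⋃ c ∈ s, ball (c : E) (ε / 2) with hA
  have hdisj : Set.Pairwise (s : Set E) (Disjoint on fun c => ball (c : E) (ε / 2)) := by
    rintro c hc d hd hcd
    apply ball_disjoint_ball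
    rw [dist_eq_norm, add_halves]
    exact h c hc d hd hcd
  have hsub : A ⊆ ball (0 : E) (R + ε / 2) := by
    refine Set.iUnion₂_subset fun x hx => ball_subset_ball' ?_
    rw [dist_zero_right, add_comm]
    gcongr
    exact hs x hx
  have I : (s.card : ℝ≥0∞) * ENNReal.ofReal ((ε / 2) ^ finrank ℝ E) * μ (ball 0 1) ≤
      ENNReal.ofReal ((R + ε / 2) ^ finrank ℝ E) * μ (ball 0 1) :=
    calc
      _ = μ A := by
        rw [hA, measure_biUnion_finset hdisj fun c _ => measurableSet_ball]
        simp only [μ.addHaar_ball_of_pos _ hδ, Finset.sum_const, nsmul_eq_mul, mul_assoc]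
      _ ≤ μ (ball (0 : E) (R + ε / 2)) := measure_mono hsub
      _ = _ := by simp only [μ.addHaar_ball_of_pos _ hρ]
  have J : (s.card : ℝ≥0∞) * ENNReal.ofReal ((ε / 2) ^ finrank ℝ E) ≤
      ENNReal.ofReal ((R + ε / 2) ^ finrank ℝ E) :=
    (ENNReal.mul_le_mul_iff_left (measure_ball_pos _ _ zero_lt_one).ne' measure_ball_lt_top.ne).1 I
  have K : (s.card : ℝ) * (ε / 2) ^ finrank ℝ E ≤ (R + ε / 2) ^ finrank ℝ E := by
    have := ENNReal.toReal_le_of_le_ofReal (pow_nonneg hρ.le _) J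
    rwa [ENNReal.toReal_mul, ENNReal.toReal_natCast,
      ENNReal.toReal_ofReal (pow_nonneg hδ.le _)] at this
  rw [← le_div_iff₀ (pow_pos hδ _), ← div_pow] at K
  have hq : (R + ε / 2) / (ε / 2) = 1 + 2 * R / ε := by
    field_simp
    ring
  rwa [hq] at K

/-- A ball of radius `R` has an `ε`-net of cardinality at most `(1 + 2 R / ε) ^ dim`. -/
theorem exists_finset_net {R ε : ℝ} (hR : 0 ≤ R) (hε : 0 < ε) :
    ∃ S : Finset E, (S.card : ℝ) ≤ (1 + 2 * R / ε) ^ finrank ℝ E ∧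
      ∀ v : E, ‖v‖ ≤ R → ∃ c ∈ S, ‖v - c‖ ≤ ε := by
  classical
  -- A separated set of maximal cardinality is a net: a point farther than `ε` from all its members
  -- could be added to it. The volume bound makes the maximum exist.
  let Q : Set ℕ := {k | ∃ S : Finset E, S.card = k ∧ (∀ c ∈ S, ‖c‖ ≤ R) ∧
    ∀ c ∈ S, ∀ d ∈ S, c ≠ d → ε ≤ ‖c - d‖}
  have hne : Q.Nonempty := ⟨0, ∅, by simp⟩
  have hbdd : BddAbove Q := by
    refine ⟨⌊(1 + 2 * R / ε) ^ finrank ℝ E⌋₊, ?_⟩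
    rintro k ⟨S, rfl, h1, h2⟩
    exact Nat.le_floor (card_le_of_separated hR hε S h1 h2)
  obtain ⟨S, hcard, h1, h2⟩ := Nat.sSup_mem hne hbdd
  refine ⟨S, card_le_of_separated hR hε S h1 h2, fun v hv => ?_⟩
  by_contra! hcon
  have hvS : v ∉ S := fun hvS => by
    have := hcon v hvS
    rw [sub_self, norm_zero] at this
    exact absurd this (not_lt.mpr hε.le)
  have hmem : (insert v S).card ∈ Q := by
    refine ⟨insert v S, rfl, ?_, ?_⟩
    · intro c hc
      rcases Finset.mem_insert.mp hc with rfl | hc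
      exacts [hv, h1 c hc]
    · intro c hc d hd hcd
      rcases Finset.mem_insert.mp hc with hc' | hc' <;>
        rcases Finset.mem_insert.mp hd with hd' | hd'
      · exact absurd (hc'.trans hd'.symm) hcd
      · exact hc' ▸ (hcon d hd').le
      · rw [norm_sub_rev]
        exact hd' ▸ (hcon c hc').le
      · exact h2 c hc' d hd' hcd
  have := le_csSup hbdd hmem
  rw [Finset.card_insert_of_notMem hvS] at this
  omega

end Covering

/-! ### Exponential Markov bounds for i.i.d. observations -/

section Sample

variable {Ω : Type*} [MeasurableSpace Ω] {N n : ℕ} {μ : Measure Ω} [IsProbabilityMeasure μ]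
  {π : Finset (Fin N) → ℝ} {p₀ : ChoiceModel N} {data : Fin n → Ω → Observation N}

theorem IsOfflineSample.integral_comp (hd : IsOfflineSample μ π p₀ data) (i : Fin n)
    (g : Observation N → ℝ) :
    ∫ ω, g (data i ω) ∂μ = ∑ s, ∑ a, π s * p₀ s a * g (s, a) := by
  let _ : MeasurableSpace (Observation N) := ⊤
  have hm : Measurable (data i) := hd.measurable i
  have : IsProbabilityMeasure (μ.map (data i)) := Measure.isProbabilityMeasure_map hm.aemeasurable
  have hg : Measurable g := fun _ _ => trivial
  rw [← integral_map hm.aemeasurable hg.aestronglyMeasurable, integral_fintype .of_finite,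
    ← Fintype.sum_prod_type' (fun s a => π s * p₀ s a * g (s, a))]
  refine Finset.sum_congr rfl fun y _ => ?_
  rw [map_measureReal_apply hm (measurableSet_singleton y), smul_eq_mul]
  congr 1
  exact hd.law i y.1 y.2

theorem IsOfflineSample.integral_prod_comp (hd : IsOfflineSample μ π p₀ data)
    (g : Observation N → ℝ) :
    ∫ ω, ∏ i, g (data i ω) ∂μ = (∑ s, ∑ a, π s * p₀ s a * g (s, a)) ^ n := by
  let _ : MeasurableSpace (Observation N) := ⊤
  have hg : Measurable g := fun _ _ => trivial
  rw [hd.indep.integral_fun_prod_comp (f := fun _ => g) (fun i => (hd.measurable i).aemeasurable)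
    (fun _ => hg.aestronglyMeasurable)]
  simp [hd.integral_comp]

theorem IsOfflineSample.integrable_prod_comp (hd : IsOfflineSample μ π p₀ data)
    (g : Observation N → ℝ) : Integrable (fun ω => ∏ i, g (data i ω)) μ := by
  let _ : MeasurableSpace (Observation N) := ⊤
  have hm : Measurable fun ω i => data i ω := measurable_pi_lambda _ hd.measurable
  have hg : Measurable g := fun _ _ => trivial
  have hG : Measurable fun D : Fin n → Observation N => ∏ i, g (D i) :=
    Finset.measurable_fun_prod _ fun i _ => hg.comp (measurable_pi_apply i)
  have : IsProbabilityMeasure (μ.map fun ω i => data i ω) :=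
    Measure.isProbabilityMeasure_map hm.aemeasurable
  exact (Integrable.of_finite (μ := μ.map fun ω i => data i ω)
    (f := fun D : Fin n → Observation N => ∏ i, g (D i))).comp_measurable hm

/-- Markov's inequality for a product of functions of the observations. -/
theorem IsOfflineSample.measure_exp_le_prod (hd : IsOfflineSample μ π p₀ data)
    (g : Observation N → ℝ) (hg : ∀ y, 0 ≤ g y) (b L : ℝ)
    (hb : ∑ s, ∑ a, π s * p₀ s a * g (s, a) ≤ b) :
    μ.real {ω | Real.exp (L + n * (b - 1)) ≤ ∏ i, g (data i ω)} ≤ Real.exp (-L) := by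
  have hmk := mul_meas_ge_le_integral_of_nonneg (μ := μ)
    (Filter.Eventually.of_forall fun ω => Finset.prod_nonneg fun i _ => hg (data i ω))
    (hd.integrable_prod_comp g) (Real.exp (L + n * (b - 1)))
  rw [hd.integral_prod_comp] at hmk
  have hle : (∑ s, ∑ a, π s * p₀ s a * g (s, a)) ^ n ≤ Real.exp (n * (b - 1)) := by
    rcases Nat.eq_zero_or_pos n with rfl | hn
    · simp
    -- No sign of `π` or `p₀` is assumed here; the sum is nonnegative because it is the expectation
    -- of `g` at an observation, which is why `n = 0` is split off.
    have h0 : 0 ≤ ∑ s, ∑ a, π s * p₀ s a * g (s, a) := by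
      rw [← hd.integral_comp ⟨0, hn⟩]
      exact integral_nonneg fun ω => hg _
    rw [Real.exp_nat_mul]
    refine pow_le_pow_left₀ h0 (hb.trans ?_) n
    have := Real.add_one_le_exp (b - 1)
    linarith
  rw [Real.exp_add] at hmk
  have he := Real.exp_pos (n * (b - 1))
  have : Real.exp (n * (b - 1)) *
      (Real.exp L * μ.real {ω | Real.exp (L + n * (b - 1)) ≤ ∏ i, g (data i ω)}) ≤
      Real.exp (n * (b - 1)) * 1 := by
    rw [Real.exp_add]
    linarith
  have := le_of_mul_le_mul_left this he
  rw [Real.exp_neg, ← one_div, le_div_iff₀ (Real.exp_pos L)]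
  linarith

/-- Union bound over the cover. The bound `b` may vary with `u`: it is the constant `1 + η` for
likelihood ratios and the affinity of `u` for their square roots. -/
theorem IsOfflineSample.measure_exists_exp_le_prod (hd : IsOfflineSample μ π p₀ data)
    {ι : Type*} (F : Finset ι) (g : ι → Observation N → ℝ) (hg : ∀ u ∈ F, ∀ y, 0 ≤ g u y)
    (b : ι → ℝ) (L ε : ℝ) (hb : ∀ u ∈ F, ∑ s, ∑ a, π s * p₀ s a * g u (s, a) ≤ b u)
    (hF : (F.card : ℝ) ≤ ε * Real.exp L) :
    μ.real {ω | ∃ u ∈ F, Real.exp (L + n * (b u - 1)) ≤ ∏ i, g u (data i ω)} ≤ ε := by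
  have hset : {ω | ∃ u ∈ F, Real.exp (L + n * (b u - 1)) ≤ ∏ i, g u (data i ω)} =
      ⋃ u ∈ F, {ω | Real.exp (L + n * (b u - 1)) ≤ ∏ i, g u (data i ω)} := by
    ext ω
    simp
  rw [hset]
  refine (measureReal_biUnion_finset_le _ _).trans ?_
  refine (Finset.sum_le_sum fun u hu =>
    hd.measure_exp_le_prod (g u) (hg u hu) (b u) L (hb u hu)).trans ?_
  rw [Finset.sum_const, nsmul_eq_mul, Real.exp_neg, ← div_eq_mul_inv, div_le_iff₀ (Real.exp_pos L)]
  exact hF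

end Sample

/-! ### Hellinger distance and likelihood ratios -/

/-- The `ℓ¹` distance is controlled by the Hellinger distance. -/
theorem sq_sum_abs_sub_le_hellinger {ι : Type*} [Fintype ι] (u v : ι → ℝ) (hu : ∀ i, 0 ≤ u i)
    (hv : ∀ i, 0 ≤ v i) :
    (∑ i, |u i - v i|) ^ 2 ≤
      (∑ i, (√(u i) - √(v i)) ^ 2) * (2 * (∑ i, u i + ∑ i, v i)) := by
  have habs : ∀ i, |u i - v i| = |√(u i) - √(v i)| * (√(u i) + √(v i)) := fun i => by
    rw [← abs_of_nonneg (add_nonneg (Real.sqrt_nonneg (u i)) (Real.sqrt_nonneg (v i))), ← abs_mul]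
    congr 1
    linear_combination Real.sq_sqrt (hv i) - Real.sq_sqrt (hu i)
  simp_rw [habs]
  -- Cauchy–Schwarz, followed by `(√u + √v) ^ 2 ≤ 2 * (u + v)`.
  refine (Finset.sum_mul_sq_le_sq_mul_sq _ _ _).trans ?_
  simp_rw [sq_abs]
  refine mul_le_mul_of_nonneg_left ?_ (Finset.sum_nonneg fun i _ => sq_nonneg _)
  rw [← Finset.sum_add_distrib, Finset.mul_sum]
  refine Finset.sum_le_sum fun i _ => ?_
  have h1 := Real.sq_sqrt (hu i)
  have h2 := Real.sq_sqrt (hv i)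
  nlinarith [sq_nonneg (√(u i) - √(v i))]

/-- The conditional probability mass functions that are positive exactly on the offered items and
the no-purchase option. -/
structure IsRegular {N : ℕ} (p : ChoiceModel N) : Prop where
  nonneg : ∀ s a, 0 ≤ p s a
  sum_eq_one : ∀ s, ∑ a, p s a = 1
  eq_zero_iff : ∀ s a, p s a = 0 ↔ ∃ b ∈ a, b ∉ s

/-- A finite set `F` of functions of mass at most `1 + η` such that each member of `P` is dominated
by a member of `F`. -/
structure IsUpperCover {N : ℕ} (F : Finset (ChoiceModel N)) (P : Set (ChoiceModel N)) (η : ℝ) :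
    Prop where
  nonneg : ∀ u ∈ F, ∀ s a, 0 ≤ u s a
  sum_le : ∀ u ∈ F, ∀ s, ∑ a, u s a ≤ 1 + η
  exists_ge : ∀ p ∈ P, ∃ u ∈ F, ∀ s a, p s a ≤ u s a

noncomputable section

/-- The likelihood ratio of `u` and `p₀`, set to `1` off the support of `p₀`. -/
def likelihoodRatio {N : ℕ} (p₀ u : ChoiceModel N) (y : Observation N) : ℝ :=
  if p₀ y.1 y.2 = 0 then 1 else u y.1 y.2 / p₀ y.1 y.2

/-- The Hellinger affinity of `u` and `p₀` when assortments are drawn from `π`. -/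
def affinity {N : ℕ} (π : Finset (Fin N) → ℝ) (p₀ u : ChoiceModel N) : ℝ :=
  ∑ s, ∑ a, π s * (√(u s a) * √(p₀ s a))

end

variable {N n : ℕ} {π : Finset (Fin N) → ℝ} {p₀ u p : ChoiceModel N}

theorem likelihoodRatio_nonneg (hp₀ : IsRegular p₀) (hu : ∀ s a, 0 ≤ u s a) (y : Observation N) :
    0 ≤ likelihoodRatio p₀ u y := by
  unfold likelihoodRatio
  split_ifs
  exacts [zero_le_one, div_nonneg (hu _ _) (hp₀.nonneg _ _)]

/-- The factor `p₀` cancels the denominator and leaves the mass of `u`; off the support of `p₀` the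
term vanishes. -/
theorem sum_likelihoodRatio_le (hπ : ∀ s, 0 ≤ π s) (hπ1 : ∑ s, π s = 1)
    (hu : ∀ s a, 0 ≤ u s a) {η : ℝ} (hη : ∀ s, ∑ a, u s a ≤ 1 + η) :
    ∑ s, ∑ a, π s * p₀ s a * likelihoodRatio p₀ u (s, a) ≤ 1 + η := by
  have h1 : ∀ s a, π s * p₀ s a * likelihoodRatio p₀ u (s, a) ≤ π s * u s a := fun s a => by
    unfold likelihoodRatio
    split_ifs with h
    · rw [show p₀ s a = 0 from h, mul_zero, zero_mul]
      exact mul_nonneg (hπ s) (hu s a)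
    · rw [mul_assoc, mul_div_cancel₀ _ h]
  calc _ ≤ ∑ s, ∑ a, π s * u s a :=
        Finset.sum_le_sum fun s _ => Finset.sum_le_sum fun a _ => h1 s a
    _ = ∑ s, π s * ∑ a, u s a := by simp_rw [Finset.mul_sum]
    _ ≤ ∑ s, π s * (1 + η) :=
        Finset.sum_le_sum fun s _ => mul_le_mul_of_nonneg_left (hη s) (hπ s)
    _ = 1 + η := by rw [← Finset.sum_mul, hπ1, one_mul]

theorem sum_sqrt_likelihoodRatio (hp₀ : IsRegular p₀) (hu : ∀ s a, 0 ≤ u s a) :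
    ∑ s, ∑ a, π s * p₀ s a * √(likelihoodRatio p₀ u (s, a)) = affinity π p₀ u := by
  refine Finset.sum_congr rfl fun s _ => Finset.sum_congr rfl fun a _ => ?_
  unfold likelihoodRatio
  split_ifs with h
  · simp [show p₀ s a = 0 from h]
  · have h' : p₀ s a ≠ 0 := h
    have hpos : 0 < √(p₀ s a) := Real.sqrt_pos.mpr (lt_of_le_of_ne (hp₀.nonneg s a) (Ne.symm h'))
    have hsq := Real.mul_self_sqrt (hp₀.nonneg s a)
    simp only
    rw [Real.sqrt_div (hu s a), mul_assoc]
    congr 1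
    rw [mul_div_assoc', div_eq_iff hpos.ne']
    linear_combination -√(u s a) * hsq

/-- Regular models share their support. Off it both logarithms are `Real.log 0 = 0`, which matches
the value `1` of `likelihoodRatio` there, so the bound holds at every observation and not only
almost surely. -/
theorem exp_log_sub_log_le_likelihoodRatio (hp₀ : IsRegular p₀) (hp : IsRegular p)
    (hpu : ∀ s a, p s a ≤ u s a) (y : Observation N) :
    Real.exp (Real.log (p y.1 y.2) - Real.log (p₀ y.1 y.2)) ≤ likelihoodRatio p₀ u y := by
  unfold likelihoodRatio
  split_ifs with h
  · have hz : p y.1 y.2 = 0 := (hp.eq_zero_iff _ _).mpr ((hp₀.eq_zero_iff _ _).mp h)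
    simp [h, hz]
  · have hz : p y.1 y.2 ≠ 0 := fun hz =>
      h ((hp₀.eq_zero_iff _ _).mpr ((hp.eq_zero_iff _ _).mp hz))
    have h0 := lt_of_le_of_ne (hp₀.nonneg y.1 y.2) (Ne.symm h)
    have h1 := lt_of_le_of_ne (hp.nonneg y.1 y.2) (Ne.symm hz)
    rw [Real.exp_sub, Real.exp_log h0, Real.exp_log h1]
    exact div_le_div_of_nonneg_right (hpu _ _) h0.le

theorem exp_empLoss_sub_le (hn : 0 < n) (hp₀ : IsRegular p₀) (hp : IsRegular p)
    (hpu : ∀ s a, p s a ≤ u s a) (D : Fin n → Observation N) :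
    Real.exp (n * (empLoss D p₀ - empLoss D p)) ≤ ∏ i, likelihoodRatio p₀ u (D i) := by
  have hn' : (n : ℝ) ≠ 0 := by positivity
  have h : n * (empLoss D p₀ - empLoss D p) =
      ∑ i, (Real.log (p (D i).1 (D i).2) - Real.log (p₀ (D i).1 (D i).2)) := by
    unfold empLoss
    rw [Finset.sum_sub_distrib]
    field_simp
    ring
  rw [h, Real.exp_sum]
  exact Finset.prod_le_prod (fun i _ => (Real.exp_pos _).le)
    fun i _ => exp_log_sub_log_le_likelihoodRatio hp₀ hp hpu (D i)

/-- A `q` whose loss is smaller than that of `p₀` by at least `L / n + η` would force the likelihood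
product of a dominating `u` up to the excluded level, so testing the finite set `F` suffices. -/
theorem mem_uncertaintySet_of_prod_lt {F : Finset (ChoiceModel N)} {P : Set (ChoiceModel N)}
    {η L α : ℝ} (hn : 0 < n) (hF : IsUpperCover F P η) (hP : ∀ q ∈ P, IsRegular q) (hp₀ : p₀ ∈ P)
    (hα : L / n + η ≤ α) (D : Fin n → Observation N)
    (hD : ∀ u ∈ F, ∏ i, likelihoodRatio p₀ u (D i) < Real.exp (L + n * (1 + η - 1))) :
    p₀ ∈ uncertaintySet P D α := by
  refine ⟨hp₀, fun q hq => ?_⟩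
  obtain ⟨u, hu, hqu⟩ := hF.exists_ge q hq
  have h := (exp_empLoss_sub_le hn (hP p₀ hp₀) (hP q hq) hqu D).trans_lt (hD u hu)
  rw [Real.exp_lt_exp] at h
  have hn' : (0 : ℝ) < n := by exact_mod_cast hn
  have hL : L = n * (L / n) := by field_simp
  rw [hL, ← mul_add, mul_lt_mul_iff_right₀ hn'] at h
  linarith

/-- Expanding the square gives the masses of `u` and `p₀` minus twice the affinity, averaged over
`π`; the term at `s` is one of the nonnegative summands. -/
theorem hellinger_le_affinity (hπ : ∀ s, 0 ≤ π s) (hπ1 : ∑ s, π s = 1) (hp₀ : IsRegular p₀)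
    (hu : ∀ s a, 0 ≤ u s a) {η : ℝ} (hη : ∀ s, ∑ a, u s a ≤ 1 + η) (s : Finset (Fin N)) :
    π s * ∑ a, (√(u s a) - √(p₀ s a)) ^ 2 ≤ 2 + η - 2 * affinity π p₀ u := by
  have h1 : ∀ s, ∑ a, (√(u s a) - √(p₀ s a)) ^ 2 =
      ∑ a, u s a + 1 - 2 * ∑ a, √(u s a) * √(p₀ s a) := fun s => by
    rw [← hp₀.sum_eq_one s, Finset.mul_sum, ← Finset.sum_add_distrib, ← Finset.sum_sub_distrib]
    refine Finset.sum_congr rfl fun a _ => ?_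
    linear_combination Real.sq_sqrt (hu s a) + Real.sq_sqrt (hp₀.nonneg s a)
  calc π s * ∑ a, (√(u s a) - √(p₀ s a)) ^ 2
      ≤ ∑ s, π s * ∑ a, (√(u s a) - √(p₀ s a)) ^ 2 :=
        Finset.single_le_sum (f := fun s => π s * ∑ a, (√(u s a) - √(p₀ s a)) ^ 2)
          (fun t _ => mul_nonneg (hπ t) (Finset.sum_nonneg fun a _ => sq_nonneg _))
          (Finset.mem_univ s)
    _ ≤ ∑ s, (π s * (2 + η) - 2 * ∑ a, π s * (√(u s a) * √(p₀ s a))) := by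
        refine Finset.sum_le_sum fun t _ => ?_
        rw [h1, ← Finset.mul_sum]
        have := mul_le_mul_of_nonneg_left (hη t) (hπ t)
        linarith
    _ = 2 + η - 2 * affinity π p₀ u := by
        rw [Finset.sum_sub_distrib, ← Finset.sum_mul, hπ1, one_mul, ← Finset.mul_sum, affinity]

/-- Membership of `p` bounds the product of square roots below by `exp (-n * α / 2)`. Against the
upper bound `hD` this leaves `1 - affinity ≤ α / 2 + L / n`, whence the constant `3 / 2`. -/
theorem one_sub_affinity_le {P : Set (ChoiceModel N)} {L α : ℝ} (hn : 0 < n) (hp₀ : IsRegular p₀)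
    (hp₀P : p₀ ∈ P) (hp : IsRegular p) (hpu : ∀ s a, p s a ≤ u s a) (hα : L / n ≤ α)
    (D : Fin n → Observation N) (hpD : p ∈ uncertaintySet P D α)
    (hD : ∏ i, √(likelihoodRatio p₀ u (D i)) < Real.exp (L + n * (affinity π p₀ u - 1))) :
    1 - affinity π p₀ u ≤ 3 / 2 * α := by
  have hu : ∀ s a, 0 ≤ u s a := fun s a => (hp.nonneg s a).trans (hpu s a)
  have hn' : (0 : ℝ) < n := by exact_mod_cast hn
  have h := (Real.sqrt_le_sqrt (exp_empLoss_sub_le hn hp₀ hp hpu D))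
  rw [Real.sqrt_prod _ fun i _ => likelihoodRatio_nonneg hp₀ hu _, ← Real.exp_half] at h
  replace h := h.trans_lt hD
  have hL : L = n * (L / n) := by field_simp
  rw [Real.exp_lt_exp, hL, ← mul_add, mul_div_assoc, mul_lt_mul_iff_right₀ hn'] at h
  have := hpD.2 p₀ hp₀P
  linarith

/-- Triangle inequality through `u`. The step from `p` to `u` costs at most the excess mass `η`, and
`η ^ 2 ≤ 5 * α`; the step from `u` to `p₀` is the Hellinger bound. The constants add up as `5 / 2 +
15 / 2 = 10`. -/
theorem sum_abs_sub_le (hπ : ∀ s, 0 ≤ π s) (hπ1 : ∑ s, π s = 1) (hp₀ : IsRegular p₀)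
    (hp : IsRegular p) (hpu : ∀ s a, p s a ≤ u s a) {η α : ℝ}
    (hη : ∀ s, ∑ a, u s a ≤ 1 + η) (hη5 : η ≤ 5) (hηα : η ≤ α)
    (hρ : 1 - affinity π p₀ u ≤ 3 / 2 * α) {s : Finset (Fin N)} (hs : 0 < π s) :
    ∑ a, |p₀ s a - p s a| ≤ 10 * √(α / π s) := by
  have hu : ∀ s a, 0 ≤ u s a := fun s a => (hp.nonneg s a).trans (hpu s a)
  have hη0 : 0 ≤ η := by
    have h := Finset.sum_le_sum fun a (_ : a ∈ Finset.univ) => hpu s a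
    rw [hp.sum_eq_one] at h
    linarith [hη s]
  have hπs1 : π s ≤ 1 := hπ1 ▸ Finset.single_le_sum (fun t _ => hπ t) (Finset.mem_univ s)
  have hα0 : 0 ≤ α := hη0.trans hηα
  have hq0 : 0 ≤ α / π s := by positivity
  have hαq : α ≤ α / π s := by
    rw [le_div_iff₀ hs]
    exact mul_le_of_le_one_right hα0 hπs1
  have h1 : ∑ a, |u s a - p s a| ≤ 5 / 2 * √(α / π s) := by
    have : ∑ a, |u s a - p s a| ≤ η := by
      simp_rw [fun a => abs_of_nonneg (sub_nonneg.mpr (hpu s a))]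
      rw [Finset.sum_sub_distrib, hp.sum_eq_one]
      linarith [hη s]
    refine this.trans (abs_le_of_sq_le_sq' ?_ (by positivity)).2
    rw [mul_pow, Real.sq_sqrt hq0]
    nlinarith
  have h2 : ∑ a, |u s a - p₀ s a| ≤ 15 / 2 * √(α / π s) := by
    have hH : ∑ a, (√(u s a) - √(p₀ s a)) ^ 2 ≤ 4 * (α / π s) := by
      have := hellinger_le_affinity hπ hπ1 hp₀ hu hη s
      rw [mul_div_assoc', le_div_iff₀ hs]
      linarith
    have := sq_sum_abs_sub_le_hellinger (u s) (p₀ s) (hu s) (hp₀.nonneg s)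
    rw [hp₀.sum_eq_one] at this
    refine (abs_le_of_sq_le_sq' (this.trans ?_) (by positivity)).2
    rw [mul_pow, Real.sq_sqrt hq0]
    -- The mass factor is `2 * (2 + η) ≤ 14`, and `4 * 14 = 56 ≤ (15 / 2) ^ 2`.
    calc _ ≤ 4 * (α / π s) * 14 := by
          refine mul_le_mul hH ?_ ?_ (by positivity)
          · linarith [hη s]
          · have := Finset.sum_nonneg fun a (_ : a ∈ Finset.univ) => hu s a
            linarith
      _ ≤ _ := by linarith
  calc ∑ a, |p₀ s a - p s a| ≤ ∑ a, (|u s a - p s a| + |u s a - p₀ s a|) :=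
        Finset.sum_le_sum fun a _ => by
          rw [abs_sub_comm (u s a) (p₀ s a), add_comm]
          exact abs_sub_le _ _ _
    _ ≤ 10 * √(α / π s) := by
        rw [Finset.sum_add_distrib]
        linarith

/-! ### Pessimism: from uncertainty sets to regret -/

section Regret

variable {r : Finset (Fin N) → Fin N → ℝ} {s : Finset (Fin N)}

theorem le_maxRevenue {a : Fin N} (ha : a ∈ s) : r s a ≤ maxRevenue r s :=
  le_ciSup (f := fun j : {j // j ∈ s} => r s j) (Set.finite_range _).bddAbove ⟨a, ha⟩

theorem maxRevenue_nonneg (hr : ∀ a ∈ s, 0 ≤ r s a) : 0 ≤ maxRevenue r s :=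
  Real.iSup_nonneg fun j => hr j j.2

theorem value_nonneg (hr : ∀ a ∈ s, 0 ≤ r s a) (hp : IsRegular p) : 0 ≤ value r p s :=
  Finset.sum_nonneg fun a ha => mul_nonneg (hp.nonneg _ _) (hr a ha)

theorem value_sub_value_le (hr : ∀ a ∈ s, 0 ≤ r s a) :
    value r p₀ s - value r p s ≤ maxRevenue r s * ∑ a, |p₀ s a - p s a| := by
  unfold value
  rw [← Finset.sum_sub_distrib]
  calc ∑ a ∈ s, (p₀ s (some a) * r s a - p s (some a) * r s a)
      ≤ ∑ a ∈ s, maxRevenue r s * |p₀ s (some a) - p s (some a)| := by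
        refine Finset.sum_le_sum fun a ha => ?_
        rw [← sub_mul, mul_comm]
        refine (mul_le_mul_of_nonneg_left (le_abs_self _) (hr a ha)).trans ?_
        exact mul_le_mul_of_nonneg_right (le_maxRevenue ha) (abs_nonneg _)
    _ ≤ ∑ a, maxRevenue r s * |p₀ s (some a) - p s (some a)| :=
        Finset.sum_le_univ_sum_of_nonneg fun a =>
          mul_nonneg (maxRevenue_nonneg hr) (abs_nonneg _)
    _ ≤ _ := by
        rw [← Finset.mul_sum, Fintype.sum_option]
        refine mul_le_mul_of_nonneg_left ?_ (maxRevenue_nonneg hr)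
        linarith [abs_nonneg (p₀ s none - p s none)]

/-- The regret of a max-min solution is at most the variation of the value of the optimal assortment
over an uncertainty set that contains the true model. -/
theorem regret_le_of_mem_solutions {𝕊 : Finset (Finset (Fin N))} {P : Set (ChoiceModel N)}
    (hP : ∀ q ∈ P, IsRegular q) (hr : ∀ s ∈ 𝕊, ∀ a ∈ s, 0 ≤ r s a) {sStar : Finset (Fin N)}
    (hStar : sStar ∈ 𝕊) {D : Fin n → Observation N} {α B : ℝ} (hp₀ : p₀ ∈ uncertaintySet P D α)
    (hB : ∀ p ∈ uncertaintySet P D α, value r p₀ sStar - value r p sStar ≤ B)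
    (hs : s ∈ solutions 𝕊 P r D α) : regret r p₀ sStar s ≤ B := by
  have h1 : worstValue P r D α s ≤ value r p₀ s := by
    -- A real `sInf` is meaningful only for a nonempty set bounded below: nonnegative revenues give
    -- the bound, and `p₀` the nonemptiness.
    refine csInf_le ⟨0, ?_⟩ ⟨p₀, hp₀, rfl⟩
    rintro _ ⟨p, hp, rfl⟩
    exact value_nonneg (hr s hs.1) (hP p hp.1)
  have h2 : value r p₀ sStar - B ≤ worstValue P r D α sStar := by
    refine le_csInf ⟨_, p₀, hp₀, rfl⟩ ?_
    rintro _ ⟨p, hp, rfl⟩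
    linarith [hB p hp]
  have h3 := hs.2 sStar hStar
  unfold regret
  linarith

end Regret

/-! ### Regret bound from an upper cover -/

/-- The regret bound for a family with a finite upper cover. -/
theorem IsOfflineSample.regret_le_of_isUpperCover {Ω : Type*} [MeasurableSpace Ω] {μ : Measure Ω}
    [IsProbabilityMeasure μ] {data : Fin n → Ω → Observation N}
    (hd : IsOfflineSample μ π p₀ data) (hn : 0 < n) (hπ : ∀ s, 0 ≤ π s) (hπ1 : ∑ s, π s = 1)
    {F : Finset (ChoiceModel N)} {P : Set (ChoiceModel N)} {η L α δ : ℝ}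
    (hF : IsUpperCover F P η) (hP : ∀ q ∈ P, IsRegular q) (hp₀ : p₀ ∈ P) (hη : η ≤ 5)
    (hη0 : 0 ≤ η) (hL : 0 ≤ L)
    (hcard : (F.card : ℝ) ≤ δ / 2 * Real.exp L) (hα : L / n + η ≤ α)
    {𝕊 : Finset (Finset (Fin N))} {r : Finset (Fin N) → Fin N → ℝ}
    (hr : ∀ s ∈ 𝕊, ∀ a ∈ s, 0 ≤ r s a) {sStar : Finset (Fin N)} (hStar : sStar ∈ 𝕊)
    (hπStar : 0 < π sStar) :
    1 - δ ≤ μ.real {ω | ∀ s ∈ solutions 𝕊 P r (fun i => data i ω) α,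
      regret r p₀ sStar s ≤ 10 * maxRevenue r sStar * √(α / π sStar)} := by
  have hR₀ := hP p₀ hp₀
  set A := {ω | ∃ u ∈ F, Real.exp (L + n * (1 + η - 1)) ≤ ∏ i, likelihoodRatio p₀ u (data i ω)}
    with hAdef
  set B := {ω | ∃ u ∈ F, Real.exp (L + n * (affinity π p₀ u - 1)) ≤
    ∏ i, √(likelihoodRatio p₀ u (data i ω))} with hBdef
  set G := {ω | ∀ s ∈ solutions 𝕊 P r (fun i => data i ω) α,
    regret r p₀ sStar s ≤ 10 * maxRevenue r sStar * √(α / π sStar)} with hGdef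
  have hA : μ.real A ≤ δ / 2 :=
    hd.measure_exists_exp_le_prod F (likelihoodRatio p₀)
      (fun u hu => likelihoodRatio_nonneg hR₀ (hF.nonneg u hu)) (fun _ => 1 + η) L (δ / 2)
      (fun u hu => sum_likelihoodRatio_le hπ hπ1 (hF.nonneg u hu) (hF.sum_le u hu)) hcard
  have hB : μ.real B ≤ δ / 2 :=
    hd.measure_exists_exp_le_prod F (fun u y => √(likelihoodRatio p₀ u y))
      (fun u _ y => Real.sqrt_nonneg _) (affinity π p₀) L (δ / 2)
      (fun u hu => (sum_sqrt_likelihoodRatio hR₀ (hF.nonneg u hu)).le) hcard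
  have hLn : 0 ≤ L / n := by positivity
  -- Covering the whole space avoids complements: monotonicity and subadditivity of the measure then
  -- suffice, with no measurability of `G`.
  have hsub : (Set.univ : Set Ω) ⊆ G ∪ (A ∪ B) := by
    intro ω _
    by_cases hω : ω ∈ A ∪ B
    · exact Or.inr hω
    refine Or.inl fun s hs => ?_
    rw [Set.mem_union, not_or, hAdef, hBdef, Set.mem_ofPred_eq, Set.mem_ofPred_eq] at hω
    push Not at hω
    obtain ⟨hωA, hωB⟩ := hω
    have hmem := mem_uncertaintySet_of_prod_lt hn hF hP hp₀ hα _ hωA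
    refine regret_le_of_mem_solutions hP hr hStar hmem (fun p hp => ?_) hs
    obtain ⟨u, hu, hpu⟩ := hF.exists_ge p hp.1
    have hρ := one_sub_affinity_le hn hR₀ hp₀ (hP p hp.1) hpu (by linarith) _ hp (hωB u hu)
    have hsum := sum_abs_sub_le hπ hπ1 hR₀ (hP p hp.1) hpu (hF.sum_le u hu) hη (by linarith) hρ
      hπStar
    refine (value_sub_value_le (hr sStar hStar)).trans ?_
    refine (mul_le_mul_of_nonneg_left hsum (maxRevenue_nonneg (hr sStar hStar))).trans (le_of_eq ?_)
    ring
  have h1 := measureReal_mono (μ := μ) hsub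
  have h2 := measureReal_union_le (μ := μ) G (A ∪ B)
  have h3 := measureReal_union_le (μ := μ) A B
  rw [probReal_univ] at h1
  linarith

/-! ### Logit models, their mixtures and an upper cover -/

variable {d K : ℕ} {x : Fin N → EuclideanSpace ℝ (Fin d)}

section Logit

variable (x) (θ θ' : EuclideanSpace ℝ (Fin d)) (s : Finset (Fin N)) (a : Option (Fin N))

theorem mnl_denom_pos : 0 < 1 + ∑ j ∈ s, Real.exp (inner ℝ (x j) θ) := by positivity

theorem mnl_nonneg : 0 ≤ mnl x θ s a := by
  have := mnl_denom_pos x θ s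
  cases a with
  | none => exact (one_div_pos.mpr this).le
  | some b =>
    simp only [mnl]
    split_ifs
    exacts [by positivity, le_rfl]

theorem mnl_eq_zero_iff : mnl x θ s a = 0 ↔ ∃ b ∈ a, b ∉ s := by
  have := mnl_denom_pos x θ s
  cases a with
  | none => simp [mnl, this.ne']
  | some b => simp [mnl, this.ne']

theorem sum_mnl : ∑ a, mnl x θ s a = 1 := by
  have := mnl_denom_pos x θ s
  rw [Fintype.sum_option]
  simp only [mnl]
  rw [← Finset.sum_filter, Finset.filter_mem_eq_inter, Finset.univ_inter, ← Finset.sum_div,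
    ← add_div, div_self this.ne']

variable {x θ θ'}

/-- Numerator and denominator each change by a factor of at most `exp (h / 2)`; the summand `1` of
the denominator is harmless since this factor is at least `1`. -/
theorem mnl_le_exp_mul_mnl {h : ℝ} (h0 : 0 ≤ h)
    (hh : ∀ j, |inner ℝ (x j) θ - inner ℝ (x j) θ'| ≤ h / 2) :
    mnl x θ s a ≤ Real.exp h * mnl x θ' s a := by
  have hone : 1 ≤ Real.exp (h / 2) := Real.one_le_exp (by positivity)
  have hhalf : Real.exp h = Real.exp (h / 2) * Real.exp (h / 2) := by
    rw [← Real.exp_add, add_halves]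
  have hD := mnl_denom_pos x θ s
  have hD' := mnl_denom_pos x θ' s
  have hexp : ∀ j, Real.exp (inner ℝ (x j) θ) ≤
      Real.exp (h / 2) * Real.exp (inner ℝ (x j) θ') := fun j => by
    rw [← Real.exp_add, Real.exp_le_exp]
    linarith [(abs_le.mp (hh j)).2]
  have hexp' : ∀ j, Real.exp (inner ℝ (x j) θ') ≤
      Real.exp (h / 2) * Real.exp (inner ℝ (x j) θ) := fun j => by
    rw [← Real.exp_add, Real.exp_le_exp]
    linarith [(abs_le.mp (hh j)).1]
  have hden : 1 + ∑ j ∈ s, Real.exp (inner ℝ (x j) θ') ≤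
      Real.exp (h / 2) * (1 + ∑ j ∈ s, Real.exp (inner ℝ (x j) θ)) := by
    rw [mul_add, mul_one, Finset.mul_sum]
    exact add_le_add hone (Finset.sum_le_sum fun j _ => hexp' j)
  have key : ∀ t t' : ℝ, 0 ≤ t' → t ≤ Real.exp (h / 2) * t' →
      t / (1 + ∑ j ∈ s, Real.exp (inner ℝ (x j) θ)) ≤
        Real.exp h * (t' / (1 + ∑ j ∈ s, Real.exp (inner ℝ (x j) θ'))) := fun t t' ht' ht => by
    rw [mul_div_assoc', div_le_div_iff₀ hD hD', hhalf]
    calc _ ≤ (Real.exp (h / 2) * t') *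
          (Real.exp (h / 2) * (1 + ∑ j ∈ s, Real.exp (inner ℝ (x j) θ))) :=
          mul_le_mul ht hden hD'.le (by positivity)
      _ = _ := by ring
  cases a with
  | none => exact key 1 1 zero_le_one (by rwa [mul_one])
  | some b =>
    simp only [mnl]
    split_ifs
    · exact key _ _ (Real.exp_pos _).le (hexp b)
    · rw [mul_zero]

end Logit

theorem exists_weight_pos {w : Fin K → ℝ} (hw : w ∈ stdSimplex ℝ (Fin K)) : ∃ k, 0 < w k := by
  by_contra! hcon
  have := Finset.sum_nonpos fun k (_ : k ∈ Finset.univ) => hcon k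
  rw [hw.2] at this
  linarith

/-- All logit components have the same support, and at least one of them has positive weight. -/
theorem isRegular_of_mem_lclFamily {T : Set (EuclideanSpace ℝ (Fin d))} {p : ChoiceModel N}
    (hp : p ∈ lclFamily K x T) : IsRegular p := by
  obtain ⟨θ, w, hw, -, rfl⟩ := hp
  have hterm : ∀ s a k, 0 ≤ w k * mnl x (θ k) s a := fun s a k =>
    mul_nonneg (hw.1 k) (mnl_nonneg x (θ k) s a)
  refine ⟨fun s a => Finset.sum_nonneg fun k _ => hterm s a k, fun s => ?_, fun s a => ?_⟩
  · unfold lcl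
    rw [Finset.sum_comm]
    simp_rw [← Finset.mul_sum, sum_mnl, mul_one]
    exact hw.2
  · unfold lcl
    rw [Finset.sum_eq_zero_iff_of_nonneg fun k _ => hterm s a k]
    constructor
    · intro h
      obtain ⟨k, hk⟩ := exists_weight_pos hw
      exact (mnl_eq_zero_iff x (θ k) s a).mp
        ((mul_eq_zero.mp (h k (Finset.mem_univ k))).resolve_left hk.ne')
    · intro h k _
      rw [(mnl_eq_zero_iff x (θ k) s a).mpr h, mul_zero]

/-- A finite set of parameters that approximates the utilities of every parameter in a ball. -/
theorem exists_finset_utility_net {Cx R h : ℝ} (hx : ∀ j, ‖x j‖ ≤ Cx) (hCx : 0 ≤ Cx) (hR : 0 ≤ R)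
    (h0 : 0 < h) :
    ∃ S : Finset (EuclideanSpace ℝ (Fin d)), (S.card : ℝ) ≤ (1 + 4 * (R * Cx) / h) ^ d ∧
      ∀ θ, ‖θ‖ ≤ R → ∃ c ∈ S, ∀ j, |inner ℝ (x j) θ - inner ℝ (x j) c| ≤ h / 2 := by
  have hinner : ∀ θ c j, |inner ℝ (x j) θ - inner ℝ (x j) c| ≤ Cx * ‖θ - c‖ := fun θ c j => by
    rw [← inner_sub_right]
    exact (abs_real_inner_le_norm _ _).trans
      (mul_le_mul_of_nonneg_right (hx j) (norm_nonneg _))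
  -- For `Cx = 0` the net radius `h / (2 * Cx)` degenerates, but all utilities vanish and one point
  -- suffices.
  rcases hCx.eq_or_lt with rfl | hpos
  · refine ⟨{0}, by simp, fun θ _ => ⟨0, Finset.mem_singleton_self 0, fun j => ?_⟩⟩
    refine (hinner θ 0 j).trans ?_
    rw [zero_mul]
    positivity
  · obtain ⟨S, hS, hnet⟩ := exists_finset_net (E := EuclideanSpace ℝ (Fin d)) hR
      (show 0 < h / (2 * Cx) by positivity)
    refine ⟨S, ?_, fun θ hθ => ?_⟩
    · rw [finrank_euclideanSpace_fin] at hS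
      convert hS using 2
      field_simp
      ring
    · obtain ⟨c, hc, hθc⟩ := hnet θ hθ
      refine ⟨c, hc, fun j => (hinner θ c j).trans ?_⟩
      refine (mul_le_mul_of_nonneg_left hθc hCx).trans (le_of_eq ?_)
      field_simp

/-- The latent class logit family has an upper cover obtained from a net of the parameter ball and a
grid of mixture weights. -/
theorem exists_isUpperCover_lclFamily {T : Set (EuclideanSpace ℝ (Fin d))} {Cx R h : ℝ} {m : ℕ}
    (hx : ∀ j, ‖x j‖ ≤ Cx) (hT : ∀ θ ∈ T, ‖θ‖ ≤ R) (hCx : 0 ≤ Cx) (hR : 0 ≤ R)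
    (h0 : 0 < h) (h1 : h ≤ 1) (hm : 0 < m) (hKm : K ≤ m * h) :
    ∃ F : Finset (ChoiceModel N), IsUpperCover F (lclFamily K x T) (5 * h) ∧
      (F.card : ℝ) ≤ ((1 + 4 * (R * Cx) / h) ^ d * (m + 1)) ^ K := by
  classical
  obtain ⟨S, hS, hnet⟩ := exists_finset_utility_net hx hCx hR h0
  have hm' : (0 : ℝ) < m := by exact_mod_cast hm
  let I : Finset (Fin K → EuclideanSpace ℝ (Fin d) × ℕ) :=
    Fintype.piFinset fun _ => S ×ˢ Finset.range (m + 1)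
  -- The factor `exp h` pays for moving a parameter to the net. Weights are rounded up to multiples
  -- of `1 / m`, so their sum grows to at most `1 + K / m ≤ 1 + h`; the filter on `I` below records
  -- this.
  let f : (Fin K → EuclideanSpace ℝ (Fin d) × ℕ) → ChoiceModel N := fun c s a =>
    ∑ k, ((c k).2 / m : ℝ) * (Real.exp h * mnl x (c k).1 s a)
  refine ⟨(I.filter fun c => ∑ k, (c k).2 ≤ m + K).image f, ⟨?_, ?_, ?_⟩, ?_⟩
  · intro u hu s a
    obtain ⟨c, -, rfl⟩ := Finset.mem_image.mp hu
    exact Finset.sum_nonneg fun k _ => mul_nonneg (by positivity)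
      (mul_nonneg (Real.exp_pos h).le (mnl_nonneg x _ s a))
  · intro u hu s
    obtain ⟨c, hc, rfl⟩ := Finset.mem_image.mp hu
    have hsum : (∑ k, ((c k).2 : ℝ)) ≤ m + K := by exact_mod_cast (Finset.mem_filter.mp hc).2
    have hexp : Real.exp h ≤ 1 + h + h ^ 2 := by
      have := (abs_le.mp (Real.abs_exp_sub_one_sub_id_le (abs_le.mpr ⟨by linarith, h1⟩))).2
      linarith
    calc ∑ a, f c s a = (∑ k, ((c k).2 : ℝ)) / m * Real.exp h := by
          simp only [f]
          rw [Finset.sum_comm]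
          simp_rw [← Finset.mul_sum, sum_mnl, mul_one]
          rw [← Finset.sum_mul, Finset.sum_div]
      _ ≤ (1 + h) * (1 + h + h ^ 2) := by
          refine mul_le_mul ?_ hexp (Real.exp_pos h).le (by positivity)
          rw [div_le_iff₀ hm']
          linarith
      _ ≤ 1 + 5 * h := by nlinarith [mul_nonneg h0.le h0.le]
  · rintro _ ⟨θ, w, hw, hθ, rfl⟩
    choose c hcS hc using fun k => hnet (θ k) (hT _ (hθ k))
    have hwle : ∀ k, w k ≤ 1 := fun k =>
      hw.2 ▸ Finset.single_le_sum (fun i _ => hw.1 i) (Finset.mem_univ k)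
    refine ⟨f fun k => (c k, ⌈w k * m⌉₊), Finset.mem_image_of_mem f
      (Finset.mem_filter.mpr ⟨?_, ?_⟩), fun s a => ?_⟩
    · refine Fintype.mem_piFinset.mpr fun k => Finset.mem_product.mpr ⟨hcS k, ?_⟩
      rw [Finset.mem_range, Nat.lt_succ_iff, Nat.ceil_le]
      exact mul_le_of_le_one_left hm'.le (hwle k)
    · have : (∑ k, (⌈w k * m⌉₊ : ℝ)) ≤ m + K := by
        calc (∑ k, (⌈w k * m⌉₊ : ℝ)) ≤ ∑ k, (w k * m + 1) :=
              Finset.sum_le_sum fun k _ =>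
                (Nat.ceil_lt_add_one (mul_nonneg (hw.1 k) hm'.le)).le
          _ = m + K := by simp [Finset.sum_add_distrib, ← Finset.sum_mul, hw.2]
      exact_mod_cast this
    · refine Finset.sum_le_sum fun k _ => mul_le_mul ?_ (mnl_le_exp_mul_mnl s a h0.le (hc k))
        (mnl_nonneg x _ s a) (by positivity)
      rw [le_div_iff₀ hm']
      exact Nat.le_ceil _
  · have hI : ((I.filter fun c => ∑ k, (c k).2 ≤ m + K).image f).card ≤ (S.card * (m + 1)) ^ K := by
      refine Finset.card_image_le.trans ((Finset.card_filter_le _ _).trans (le_of_eq ?_))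
      simp [I, Fintype.card_piFinset]
    calc _ ≤ ((S.card * (m + 1) : ℝ)) ^ K := by exact_mod_cast hI
      _ ≤ _ := by gcongr

/-- The cardinality bound of the upper cover in terms of `Y = C / h`. -/
theorem cover_card_le_exp {B h : ℝ} {m : ℕ} (hN : 2 ≤ N) (hK : 1 ≤ K) (hd : 1 ≤ d) (hB : 0 ≤ B)
    (h0 : 0 < h) (h1 : h ≤ 1) (hm : (m : ℝ) ≤ K / h + 1) :
    ((1 + 4 * B / h) ^ d * (m + 1)) ^ K ≤
      Real.exp (4 * (effDim K d * Real.log (K * N * Real.exp B / h))) := by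
  set Y := K * N * Real.exp B / h with hYdef
  have hN' : (2 : ℝ) ≤ N := by exact_mod_cast hN
  have hK' : (1 : ℝ) ≤ K := by exact_mod_cast hK
  have hd' : (1 : ℝ) ≤ d := by exact_mod_cast hd
  have hexp : 1 + B ≤ Real.exp B := by linarith [Real.add_one_le_exp B]
  have hKN : 2 * (K : ℝ) ≤ K * N := by nlinarith
  have hY1 : 2 * K * (1 + B) / h ≤ Y := by
    rw [hYdef]
    gcongr
  have hh : 1 ≤ 1 / h := by rwa [one_le_div h0]
  have hY2 : 2 / h + 2 * B / h ≤ Y := by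
    refine le_trans ?_ hY1
    rw [← add_div]
    gcongr
    nlinarith
  have hY3 : 2 * (K / h) ≤ Y := by
    refine le_trans ?_ hY1
    rw [mul_div_assoc']
    exact div_le_div_of_nonneg_right (by nlinarith) h0.le
  have hBh : 0 ≤ B / h := by positivity
  have hY : 2 ≤ Y := by
    rw [mul_div_assoc, div_eq_mul_one_div] at hY2
    linarith
  have hnet : 1 + 4 * B / h ≤ Y ^ 2 := by
    rw [div_eq_mul_one_div 2 h, mul_div_assoc] at hY2
    rw [mul_div_assoc]
    nlinarith
  have hgrid : (m + 1 : ℝ) ≤ Y ^ 2 := by nlinarith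
  have hlog : 0 ≤ Real.log Y := Real.log_nonneg (by linarith)
  have hnet0 : 0 ≤ 1 + 4 * B / h := by positivity
  -- Crude bounds by `Y ^ 2`, available because `N ≥ 2` forces `Y ≥ 2`.
  calc ((1 + 4 * B / h) ^ d * (m + 1)) ^ K ≤ ((Y ^ 2) ^ d * Y ^ 2) ^ K := by gcongr
    _ = Y ^ (2 * (d + 1) * K) := by ring
    _ = Real.exp ((2 * (d + 1) * K : ℕ) * Real.log Y) := by
        rw [Real.exp_nat_mul, Real.exp_log (by linarith)]
    _ ≤ _ := by
        -- The grid ignores that the weights sum to one, so the exponent is `2 * (d + 1) * K = 2 *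
        -- (D + 1)` with `D = effDim K d`; this is at most `4 * D` since `D ≥ 1`.
        rw [Real.exp_le_exp, ← mul_assoc]
        refine mul_le_mul_of_nonneg_right ?_ hlog
        unfold effDim
        push_cast
        nlinarith

/-- With one item, `C n / D` can equal `1`, and its logarithm then cannot absorb the additive
constants. In that case there is only one nonempty assortment. -/
theorem regret_eq_zero_of_le_one (hN : N ≤ 1) {r : Finset (Fin N) → Fin N → ℝ} {p : ChoiceModel N}
    {s t : Finset (Fin N)} (hs : s ≠ ∅) (ht : t ≠ ∅) : regret r p s t = 0 := by
  have : Subsingleton (Fin N) := Fin.subsingleton_iff_le_one.mpr hN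
  have huniv : ∀ u : Finset (Fin N), u ≠ ∅ → u = Finset.univ := fun u hu => by
    obtain ⟨a, ha⟩ := Finset.nonempty_iff_ne_empty.mpr hu
    exact Finset.eq_univ_of_forall fun b => Subsingleton.elim a b ▸ ha
  rw [huniv s hs, huniv t ht, regret, sub_self]

end PASTA

/-! ### Choice of scale and constants -/

theorem mainTheorem6 :
    ∃ c₁ c₂ : ℝ, 0 < c₁ ∧ 0 < c₂ ∧
      ∀ (N d K n : ℕ), 0 < d →
      ∀ (x : Fin N → EuclideanSpace ℝ (Fin d)) (T : Set (EuclideanSpace ℝ (Fin d))) (Cx CΘ : ℝ),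
        (∀ j, ‖x j‖ ≤ Cx) → (∀ θ ∈ T, ‖θ‖ ≤ CΘ) →
      ∀ (𝕊 : Finset (Finset (Fin N))), ∅ ∉ 𝕊 →
      ∀ (r : Finset (Fin N) → Fin N → ℝ), (∀ s ∈ 𝕊, ∀ a ∈ s, 0 ≤ r s a) →
      ∀ (π : Finset (Fin N) → ℝ), (∀ s, 0 ≤ π s) → (∀ s, s ∉ 𝕊 → π s = 0) → ∑ s ∈ 𝕊, π s = 1 →
      ∀ p₀ ∈ PASTA.lclFamily K x T,
      ∀ sStar : Finset (Fin N), PASTA.IsOptimal 𝕊 r p₀ sStar → 0 < π sStar →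
      ∀ {Ω : Type*} [MeasurableSpace Ω] (μ : MeasureTheory.Measure Ω)
        [MeasureTheory.IsProbabilityMeasure μ] (data : Fin n → Ω → PASTA.Observation N),
        PASTA.IsOfflineSample μ π p₀ data →
      PASTA.effDim K d ≤ n →
      ∀ δ : ℝ, 0 < δ → δ < 1 →
      ∀ α : ℝ,
        c₁ * PASTA.rate (PASTA.effDim K d) (K * N * Real.exp (CΘ * Cx)) n δ ≤ α →
        1 - δ ≤ μ.real {ω |
          ∀ s ∈ PASTA.solutions 𝕊 (PASTA.lclFamily K x T) r (fun i => data i ω) α,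
            PASTA.regret r p₀ sStar s ≤
              c₂ * PASTA.maxRevenue r sStar * Real.sqrt (α / π sStar)} := by
  refine ⟨15, 10, by norm_num, by norm_num, ?_⟩
  intro N d K n hd x T Cx CΘ hx hT 𝕊 h𝕊 r hr π hπ hπ𝕊 hπ1 p₀ hp₀ sStar hStar hπStar Ω _ μ _ data
    hdata hDn δ hδ0 hδ1 α hα
  rcases Nat.lt_or_ge N 2 with hN | hN
  · have hall : {ω | ∀ s ∈ PASTA.solutions 𝕊 (PASTA.lclFamily K x T) r (fun i => data i ω) α,
        PASTA.regret r p₀ sStar s ≤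
          10 * PASTA.maxRevenue r sStar * Real.sqrt (α / π sStar)} = Set.univ := by
      refine Set.eq_univ_of_forall fun ω s hs => ?_
      rw [PASTA.regret_eq_zero_of_le_one (by omega) (fun h => h𝕊 (h ▸ hStar.1))
        (fun h => h𝕊 (h ▸ hs.1))]
      exact mul_nonneg (mul_nonneg (by norm_num) (PASTA.maxRevenue_nonneg (hr _ hStar.1)))
        (Real.sqrt_nonneg _)
    rw [hall, MeasureTheory.probReal_univ]
    linarith
  have hCx : 0 ≤ Cx := (norm_nonneg _).trans (hx ⟨0, by omega⟩)
  obtain ⟨hK, hCΘ⟩ : 1 ≤ K ∧ 0 ≤ CΘ := by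
    obtain ⟨θ, w, hw, hθ, -⟩ := hp₀
    obtain ⟨k, -⟩ := PASTA.exists_weight_pos hw
    exact ⟨k.pos, (norm_nonneg _).trans (hT _ (hθ k))⟩
  have hK' : (1 : ℝ) ≤ K := by exact_mod_cast hK
  have hN' : (2 : ℝ) ≤ N := by exact_mod_cast hN
  have hd' : (1 : ℝ) ≤ d := by exact_mod_cast hd
  set D := PASTA.effDim K d with hDdef
  have hD1 : 1 ≤ D := by
    rw [hDdef, PASTA.effDim]
    nlinarith
  have hD0 : 0 < D := by linarith
  have hn0 : (0 : ℝ) < n := by linarith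
  have hn : 0 < n := by exact_mod_cast hn0
  -- At this scale the excess mass `η = 5 * h` is of the order of the rate, and `n ≥ D` gives `h ≤
  -- 1`, hence `η ≤ 5`.
  set h := D / n with hhdef
  have h0 : 0 < h := by positivity
  have h1 : h ≤ 1 := (div_le_one hn0).mpr hDn
  have hB : 0 ≤ CΘ * Cx := mul_nonneg hCΘ hCx
  have hKh : 0 < K / h := by positivity
  obtain ⟨F, hF, hcard⟩ := PASTA.exists_isUpperCover_lclFamily (K := K) (m := ⌈K / h⌉₊) hx hT hCx
    hCΘ h0 h1 (Nat.ceil_pos.mpr hKh) (by rw [← div_le_iff₀ h0]; exact Nat.le_ceil _)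
  replace hcard := hcard.trans
    (PASTA.cover_card_le_exp hN hK hd hB h0 h1 (Nat.ceil_lt_add_one hKh.le).le)
  have hYeq : K * N * Real.exp (CΘ * Cx) / h = K * N * Real.exp (CΘ * Cx) * n / D := by
    rw [hhdef]
    field_simp
  rw [hYeq, ← hDdef] at hcard
  have hY : 2 ≤ K * N * Real.exp (CΘ * Cx) * n / D := by
    rw [← hYeq, le_div_iff₀ h0]
    have := Real.one_le_exp hB
    nlinarith [mul_le_mul hK' hN' (by norm_num) (by linarith)]
  set l := Real.log (K * N * Real.exp (CΘ * Cx) * n / D) with hl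
  have hl2 : Real.log 2 ≤ l := Real.log_le_log (by norm_num) hY
  have hlog2 := Real.log_two_gt_d9
  have hDl : l ≤ D * l := le_mul_of_one_le_left (by linarith) hD1
  have hlδ : 0 ≤ Real.log (1 / δ) := Real.log_nonneg (by rw [one_le_div hδ0]; exact hδ1.le)
  -- `L` is chosen so that `δ / 2 * exp L` equals the bound on the cardinality of the cover.
  have hL : Real.exp (Real.log 2 + Real.log (1 / δ) + 4 * (D * l)) =
      2 / δ * Real.exp (4 * (D * l)) := by
    rw [Real.exp_add, Real.exp_add, Real.exp_log (by norm_num), Real.exp_log (by positivity)]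
    ring
  have hsum : ∑ s, π s = 1 := by
    rw [← hπ1]
    exact (Finset.sum_subset (Finset.subset_univ 𝕊) fun s _ hs => hπ𝕊 s hs).symm
  refine hdata.regret_le_of_isUpperCover hn hπ hsum hF
    (fun q hq => PASTA.isRegular_of_mem_lclFamily hq) hp₀ (by linarith) (by linarith)
    (L := Real.log 2 + Real.log (1 / δ) + 4 * (D * l)) (by linarith) ?_ ?_ hr hStar.1 hπStar
  · rw [hL]
    have hδ2 : δ / 2 * (2 / δ * Real.exp (4 * (D * l))) = Real.exp (4 * (D * l)) := by
      field_simp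
    rwa [hδ2]
  · refine le_trans ?_ hα
    have hrate : 15 * PASTA.rate D (K * N * Real.exp (CΘ * Cx)) n δ =
        15 * (D * l + Real.log (1 / δ)) / n := by
      rw [PASTA.rate, ← hl]
      ring
    rw [hrate, hhdef, mul_div_assoc', ← add_div]
    refine div_le_div_of_nonneg_right ?_ hn0.le
    -- The numerator on the left is `log 2 + log (1 / δ) + 4 * D * l + 5 * D`. Since `log 2 ≤ l ≤ D
    -- * l` and `5 * D ≤ 5 * D * l / log 2 < 8 * D * l`, it is below `13 * D * l + log (1 / δ)`,
    -- within the constant `15`.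
    nlinarith
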